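/- **Theorem.** For $t\in\mathbb R^3$ let $[t]_\times$ be the matrix of $x\mapsto t\times x$. Let $n$ be a natural number and let $E\in\mathbb R^{3n\times 3n}$, with $3\times3$ blocks $E_{ij}$, be an $n$-view essential matrix: $E$ is symmetric, $E_{ii}=0$ for all $i$, and for all $i\ne j$ the block $E_{ij}$ has rank $2$ and its two nonzero singular values are equal. A calibrated camera with orientation $R_i\in SO(3)$ and location $t_i\in\mathbb R^3$ has the camera matrix $P_i=[\,R_i^T \mid -R_i^T t_i\,]\in\mathbb R^{3\times4}$. Cameras $P_1,\dots,P_n$ are consistent with $E$ if $E_{ij}=R_i^T([t_i]_\times-[t_j]_\times)R_j$ for all $i,j$, and $E$ is consistent if such cameras exist. Let $E$ be a consistent $n$-view essential matrix, and let $P_1,\dots,P_n$ be calibrated cameras that are consistent with $E$ and whose locations $t_1,\dots,t_n$ do not all lie on one line. Then these cameras are unique up to a global similarity transformation: for any calibrated cameras $P_1',\dots,P_n'$ that are consistent with $E$ there are a scale $s>0$, a rotation $R\in SO(3)$ and a vector $t\in\mathbb R^3$ such that, for every $i=1,\dots,n$, $$P_i'=\frac1s\,P_i\begin{bmatrix}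 sR & t\\ 0^T & 1\end{bmatrix}=\left[\,R_i^T R \;\Big|\; \tfrac1s R_i^T(t-t_i)\,\right].$$ -/

import Mathlib

namespace MultiView

open Matrix

/-- The skew-symmetric matrix `[t]_×` of the cross product `x ↦ t × x`. -/
def crossMatrix (t : Fin 3 → ℝ) : Matrix (Fin 3) (Fin 3) ℝ :=
  !![0, -t 2, t 1; t 2, 0, -t 0; -t 1, t 0, 0]

theorem crossMatrix_mulVec (t x : Fin 3 → ℝ) : crossMatrix t *ᵥ x = crossProduct t x := by
  ext i
  fin_cases i <;> simp [crossMatrix, cross_apply, Matrix.mulVec, dotProduct, Fin.sum_univ_three] <;>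
    ring

/-- A calibrated camera: an orientation `R ∈ SO(3)` and a location (centre) `t ∈ ℝ³`. -/
structure Camera where
  R : Matrix (Fin 3) (Fin 3) ℝ
  R_mem : R ∈ Matrix.specialOrthogonalGroup (Fin 3) ℝ
  t : Fin 3 → ℝ

/-- The `3 × 4` camera matrix `[Rᵀ | -Rᵀ t]`; columns are indexed by `Fin 3 ⊕ Fin 1`. -/
def Camera.toMatrix (P : Camera) : Matrix (Fin 3) (Fin 3 ⊕ Fin 1) ℝ :=
  Matrix.fromCols P.Rᵀ (Matrix.replicateCol (Fin 1) (-(P.Rᵀ *ᵥ P.t)))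

/-- The data of a similarity transformation of `ℝ³`: scale `s > 0`, rotation `R`, translation `t`. -/
structure Similarity where
  s : ℝ
  s_pos : 0 < s
  R : Matrix (Fin 3) (Fin 3) ℝ
  R_mem : R ∈ Matrix.specialOrthogonalGroup (Fin 3) ℝ
  t : Fin 3 → ℝ

/-- The `4 × 4` matrix `[[s R, t], [0, 1]]` of a similarity transformation. -/
def Similarity.toMatrix (S : Similarity) : Matrix (Fin 3 ⊕ Fin 1) (Fin 3 ⊕ Fin 1) ℝ :=
  Matrix.fromBlocks (S.s • S.R) (Matrix.replicateCol (Fin 1) S.t) 0 1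

/-- The action of a similarity on a camera matrix, `P ↦ P S`, brought back to calibrated format
(left block a rotation) by dividing the homogeneous matrix `P S` by the scale `s`. -/
noncomputable def Similarity.apply (S : Similarity) (P : Matrix (Fin 3) (Fin 3 ⊕ Fin 1) ℝ) :
    Matrix (Fin 3) (Fin 3 ⊕ Fin 1) ℝ :=
  S.s⁻¹ • (P * S.toMatrix)

/-- Explicit form of the action: `S(P) = [R_Pᵀ R | R_Pᵀ (t - t_P) / s]`. -/
theorem Similarity.apply_toMatrix (S : Similarity) (P : Camera) :
    S.apply P.toMatrix =
      Matrix.fromCols (P.Rᵀ * S.R)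
        (Matrix.replicateCol (Fin 1) (S.s⁻¹ • (P.Rᵀ *ᵥ (S.t - P.t)))) := by
  have hs : S.s ≠ 0 := S.s_pos.ne'
  rw [Similarity.apply, Camera.toMatrix, Similarity.toMatrix, Matrix.fromCols_mul_fromBlocks]
  ext i (j | j)
  · simp [hs]
  · simp [Matrix.mulVec_sub, Matrix.mul_apply, Matrix.mulVec, dotProduct]
    left
    ring

/-- The `3 × 3` block `E_{ij}` of a `3n × 3n` matrix. -/
def block {n : ℕ} (E : Matrix (Fin n × Fin 3) (Fin n × Fin 3) ℝ) (i j : Fin n) :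
    Matrix (Fin 3) (Fin 3) ℝ :=
  Matrix.of fun a b => E (i, a) (j, b)

/-- An `n`-view essential matrix: symmetric, zero diagonal blocks, and every off-diagonal block has
rank two with its two nonzero singular values equal. The singular values
`LinearMap.singularValues` are listed in decreasing order from index `0`, so for a matrix of rank
two the nonzero ones have indices `0` and `1`. -/
structure IsNViewEssential {n : ℕ} (E : Matrix (Fin n × Fin 3) (Fin n × Fin 3) ℝ) : Prop where
  symm : E.IsSymm
  diag : ∀ i, block E i i = 0
  rank_two : ∀ i j, i ≠ j → (block E i j).rank = 2
  singularValues_eq : ∀ i j, i ≠ j →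
    (Matrix.toEuclideanLin (block E i j)).singularValues 0 =
      (Matrix.toEuclideanLin (block E i j)).singularValues 1

/-- The cameras `P` are consistent with `E`: `E_{ij} = R_iᵀ ([t_i]_× - [t_j]_×) R_j`. -/
def ConsistentWith {n : ℕ} (P : Fin n → Camera)
    (E : Matrix (Fin n × Fin 3) (Fin n × Fin 3) ℝ) : Prop :=
  ∀ i j, block E i j = (P i).Rᵀ * (crossMatrix (P i).t - crossMatrix (P j).t) * (P j).R

/-- A consistent `n`-view essential matrix. -/
def IsConsistentEssential {n : ℕ} (E : Matrix (Fin n × Fin 3) (Fin n × Fin 3) ℝ) : Prop :=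
  IsNViewEssential E ∧ ∃ P : Fin n → Camera, ConsistentWith P E

/-- The cameras are non-collinear: their centres do not all lie on one line. -/
def NonCollinear {n : ℕ} (P : Fin n → Camera) : Prop :=
  ¬ Collinear ℝ (Set.range fun i => (P i).t)

end MultiView

namespace MultiView

open Matrix

/-! Put `A i = R'_i R_iᵀ`. Consistency of both families gives `[t'_i - t'_j]_× = A i [t_i - t_j]_×
(A j)ᵀ`. Taking adjugates leaves rank-one matrices, whence `A i` and `A j` send the baseline `t_i -
t_j` to the same vector `±(t'_i - t'_j)` (`mulVec_eq_or_eq_neg_of_crossMatrix_eq`). On a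
nondegenerate triangle the three signs must agree, so `A i` and `A j` coincide on two independent
vectors and are equal (`eq_of_crossMatrix_triangle`). Non-collinearity puts every pair of cameras in
such a triangle, so all `A i` are one rotation, which carries the old baselines to the new ones. -/

theorem crossMatrix_sub (u v : Fin 3 → ℝ) :
    crossMatrix (u - v) = crossMatrix u - crossMatrix v := by
  ext i j
  fin_cases i <;> fin_cases j <;> simp [crossMatrix] <;> ring

theorem crossMatrix_injective : Function.Injective crossMatrix := by
  intro u v h
  have h0 := congrFun₂ h 2 1
  have h1 := congrFun₂ h 0 2
  have h2 := congrFun₂ h 1 0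
  ext i
  fin_cases i <;> simp_all [crossMatrix]

theorem adjugate_crossMatrix (u : Fin 3 → ℝ) : (crossMatrix u).adjugate = vecMulVec u u := by
  ext i j
  fin_cases i <;> fin_cases j <;> simp [crossMatrix, adjugate_fin_three, vecMulVec_apply] <;> ring

theorem transpose_mul_self_of_mem_SO {A : Matrix (Fin 3) (Fin 3) ℝ}
    (hA : A ∈ specialOrthogonalGroup (Fin 3) ℝ) : Aᵀ * A = 1 :=
  (mem_orthogonalGroup_iff' (Fin 3) ℝ).1 (mem_specialOrthogonalGroup_iff.1 hA).1

theorem self_mul_transpose_of_mem_SO {A : Matrix (Fin 3) (Fin 3) ℝ}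
    (hA : A ∈ specialOrthogonalGroup (Fin 3) ℝ) : A * Aᵀ = 1 :=
  (mem_orthogonalGroup_iff (Fin 3) ℝ).1 (mem_specialOrthogonalGroup_iff.1 hA).1

theorem transpose_mem_SO {A : Matrix (Fin 3) (Fin 3) ℝ}
    (hA : A ∈ specialOrthogonalGroup (Fin 3) ℝ) : Aᵀ ∈ specialOrthogonalGroup (Fin 3) ℝ := by
  refine mem_specialOrthogonalGroup_iff.2 ⟨(mem_orthogonalGroup_iff (Fin 3) ℝ).2 ?_, ?_⟩
  · simpa [star_eq_conjTranspose] using transpose_mul_self_of_mem_SO hA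
  · rw [det_transpose]
    exact (mem_specialOrthogonalGroup_iff.1 hA).2

theorem adjugate_of_mem_SO {A : Matrix (Fin 3) (Fin 3) ℝ}
    (hA : A ∈ specialOrthogonalGroup (Fin 3) ℝ) : A.adjugate = Aᵀ := by
  have h : A.adjugate * A = 1 := by
    rw [adjugate_mul, (mem_specialOrthogonalGroup_iff.1 hA).2, one_smul]
  calc A.adjugate = A.adjugate * (A * Aᵀ) := by rw [self_mul_transpose_of_mem_SO hA, mul_one]
    _ = Aᵀ := by rw [← mul_assoc, h, one_mul]

theorem dotProduct_mulVec_of_mem_SO {A : Matrix (Fin 3) (Fin 3) ℝ}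
    (hA : A ∈ specialOrthogonalGroup (Fin 3) ℝ) (u v : Fin 3 → ℝ) :
    A *ᵥ u ⬝ᵥ A *ᵥ v = u ⬝ᵥ v := by
  rw [dotProduct_mulVec, vecMul_mulVec, transpose_mul_self_of_mem_SO hA, vecMul_one]

theorem crossProduct_mulVec (A : Matrix (Fin 3) (Fin 3) ℝ) (u v : Fin 3 → ℝ) :
    crossProduct (A *ᵥ u) (A *ᵥ v) = A.adjugateᵀ *ᵥ crossProduct u v := by
  ext i
  fin_cases i <;>
    simp [cross_apply, mulVec, dotProduct, Fin.sum_univ_three, adjugate_fin_three] <;> ring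

theorem crossProduct_mulVec_of_mem_SO {A : Matrix (Fin 3) (Fin 3) ℝ}
    (hA : A ∈ specialOrthogonalGroup (Fin 3) ℝ) (u v : Fin 3 → ℝ) :
    crossProduct (A *ᵥ u) (A *ᵥ v) = A *ᵥ crossProduct u v := by
  rw [crossProduct_mulVec, adjugate_of_mem_SO hA, transpose_transpose]

theorem crossMatrix_mulVec_of_mem_SO {A : Matrix (Fin 3) (Fin 3) ℝ}
    (hA : A ∈ specialOrthogonalGroup (Fin 3) ℝ) (u : Fin 3 → ℝ) :
    crossMatrix (A *ᵥ u) = A * crossMatrix u * Aᵀ := by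
  have h : crossMatrix (A *ᵥ u) * A = A * crossMatrix u := by
    refine ext_of_mulVec_single fun i => ?_
    rw [← mulVec_mulVec, ← mulVec_mulVec, crossMatrix_mulVec, crossMatrix_mulVec,
      crossProduct_mulVec_of_mem_SO hA]
  rw [← h, mul_assoc, self_mul_transpose_of_mem_SO hA, mul_one]

/-- A rotation is determined by its values on two linearly independent vectors. -/
theorem eq_of_mulVec_eq_of_mem_SO {A B : Matrix (Fin 3) (Fin 3) ℝ}
    (hA : A ∈ specialOrthogonalGroup (Fin 3) ℝ) (hB : B ∈ specialOrthogonalGroup (Fin 3) ℝ)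
    {u v : Fin 3 → ℝ} (huv : crossProduct u v ≠ 0) (hu : A *ᵥ u = B *ᵥ u)
    (hv : A *ᵥ v = B *ᵥ v) : A = B := by
  have hw : A *ᵥ crossProduct u v = B *ᵥ crossProduct u v := by
    rw [← crossProduct_mulVec_of_mem_SO hA, ← crossProduct_mulVec_of_mem_SO hB, hu, hv]
  set F : Matrix (Fin 3) (Fin 3) ℝ := (of ![u, v, crossProduct u v])ᵀ with hF
  have hdet : F.det ≠ 0 := by
    have : F.det = crossProduct u v ⬝ᵥ crossProduct u v := by
      simp [hF, det_fin_three, cross_apply, dotProduct, Fin.sum_univ_three]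
      ring
    rw [this]
    exact fun h => huv (dotProduct_self_eq_zero.1 h)
  have hAB : A * F = B * F := by
    ext i j
    fin_cases j
    · exact congrFun hu i
    · exact congrFun hv i
    · exact congrFun hw i
  exact ((isUnit_iff_isUnit_det F).2 (isUnit_iff_ne_zero.2 hdet)).mul_right_cancel hAB

/-- Testing the rank-one identity on `u`, `v`, `w` and taking its trace forces equality in
Cauchy–Schwarz for `v`, `w`; as their lengths agree, `v = w`. Then `(u ⬝ᵥ w)² = (u ⬝ᵥ u)²` leaves
only a sign. -/
theorem eq_or_eq_neg_of_vecMulVec_eq {u v w : Fin 3 → ℝ}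
    (h : vecMulVec u u = vecMulVec v w) (hvw : v ⬝ᵥ v = w ⬝ᵥ w) :
    (w = u ∧ v = u) ∨ (w = -u ∧ v = -u) := by
  have key : ∀ a b : Fin 3 → ℝ, (a ⬝ᵥ u) * (u ⬝ᵥ b) = (a ⬝ᵥ v) * (w ⬝ᵥ b) := by
    intro a b
    have := congrArg (fun M => a ⬝ᵥ M *ᵥ b) h
    simpa [vecMulVec_mulVec, mul_comm] using this
  have htr : u ⬝ᵥ u = v ⬝ᵥ w := by
    have := congrArg trace h
    simpa [trace_vecMulVec] using this
  have hnn : ∀ a : Fin 3 → ℝ, 0 ≤ a ⬝ᵥ a := fun a => by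
    simpa using dotProduct_star_self_nonneg a
  have hN : u ⬝ᵥ u = v ⬝ᵥ v := by
    have h1 := key v w
    have h2 := key u u
    have h3 : (u ⬝ᵥ u) ^ 2 = (v ⬝ᵥ v) ^ 2 := by
      have h4 : (v ⬝ᵥ u) * (u ⬝ᵥ w) = (u ⬝ᵥ u) ^ 2 := by
        rw [sq, h2, dotProduct_comm v u, dotProduct_comm w u]
      rw [← h4, h1, ← hvw, sq]
    exact (sq_eq_sq₀ (hnn u) (hnn v)).1 h3
  have hwv : w = v := by
    refine sub_eq_zero.1 (dotProduct_self_eq_zero.1 ?_)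
    simp only [sub_dotProduct, dotProduct_sub, dotProduct_comm w v]
    linarith
  subst hwv
  have h5 : (u ⬝ᵥ w - u ⬝ᵥ u) * (u ⬝ᵥ w + u ⬝ᵥ u) = 0 := by
    have := key u u
    rw [dotProduct_comm w u] at this
    linear_combination -this
  rcases mul_eq_zero.1 h5 with h6 | h6
  · have : w = u := by
      refine sub_eq_zero.1 (dotProduct_self_eq_zero.1 ?_)
      simp only [sub_dotProduct, dotProduct_sub, dotProduct_comm w u]
      linarith
    exact Or.inl ⟨this, this⟩
  · have : w = -u := by
      refine eq_neg_of_add_eq_zero_left (dotProduct_self_eq_zero.1 ?_)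
      simp only [add_dotProduct, dotProduct_add, dotProduct_comm w u]
      linarith
    exact Or.inr ⟨this, this⟩

/-- Two factorizations of one essential matrix have the same baseline up to a common sign. -/
theorem mulVec_eq_or_eq_neg_of_crossMatrix_eq {A B : Matrix (Fin 3) (Fin 3) ℝ}
    (hA : A ∈ specialOrthogonalGroup (Fin 3) ℝ) (hB : B ∈ specialOrthogonalGroup (Fin 3) ℝ)
    {u u' : Fin 3 → ℝ} (h : crossMatrix u' = A * crossMatrix u * Bᵀ) :
    (A *ᵥ u = u' ∧ B *ᵥ u = u') ∨ (A *ᵥ u = -u' ∧ B *ᵥ u = -u') := by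
  refine eq_or_eq_neg_of_vecMulVec_eq ?_ ?_
  · rw [← adjugate_crossMatrix, h, adjugate_mul_distrib, adjugate_mul_distrib,
      adjugate_crossMatrix, adjugate_of_mem_SO hA, adjugate_of_mem_SO (transpose_mem_SO hB),
      transpose_transpose, vecMulVec_mul, mul_vecMulVec, vecMul_transpose]
  · rw [dotProduct_mulVec_of_mem_SO hA, dotProduct_mulVec_of_mem_SO hB]

theorem eq_of_mulVec_triangle {A B : Matrix (Fin 3) (Fin 3) ℝ}
    (hA : A ∈ specialOrthogonalGroup (Fin 3) ℝ) (hB : B ∈ specialOrthogonalGroup (Fin 3) ℝ)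
    {u v u' v' : Fin 3 → ℝ} (huv : crossProduct u v ≠ 0)
    (h : crossMatrix u' = A * crossMatrix u * Bᵀ) {σ : ℝ}
    (hAu : A *ᵥ u = σ • u') (hBu : B *ᵥ u = σ • u') (hBv : B *ᵥ v = σ • v')
    (hAuv : A *ᵥ (u + v) = σ • (u' + v')) : A = B ∧ u' = A *ᵥ u := by
  have hAv : A *ᵥ v = σ • v' := by
    rw [mulVec_add, hAu, smul_add] at hAuv
    exact add_left_cancel hAuv
  have hAB := eq_of_mulVec_eq_of_mem_SO hA hB huv (hAu.trans hBu.symm) (hAv.trans hBv.symm)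
  -- With `A = B`, `h` reads `[u']_× = [A u]_×`, which settles the baseline without determining `σ`.
  refine ⟨hAB, crossMatrix_injective ?_⟩
  rw [crossMatrix_mulVec_of_mem_SO hA, h, hAB]

/-- The essential matrices of a nondegenerate triangle determine the relative rotations. -/
theorem eq_of_crossMatrix_triangle {A B C : Matrix (Fin 3) (Fin 3) ℝ}
    (hA : A ∈ specialOrthogonalGroup (Fin 3) ℝ) (hB : B ∈ specialOrthogonalGroup (Fin 3) ℝ)
    (hC : C ∈ specialOrthogonalGroup (Fin 3) ℝ)
    {u v u' v' : Fin 3 → ℝ} (huv : crossProduct u v ≠ 0)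
    (hAB : crossMatrix u' = A * crossMatrix u * Bᵀ)
    (hBC : crossMatrix v' = B * crossMatrix v * Cᵀ)
    (hAC : crossMatrix (u' + v') = A * crossMatrix (u + v) * Cᵀ) :
    A = B ∧ u' = A *ᵥ u := by
  have hu : 0 < u ⬝ᵥ u := by
    refine lt_of_le_of_ne (by simpa using dotProduct_star_self_nonneg u) fun h => huv ?_
    rw [dotProduct_self_eq_zero.1 h.symm]
    simp
  have hv : 0 < v ⬝ᵥ v := by
    refine lt_of_le_of_ne (by simpa using dotProduct_star_self_nonneg v) fun h => huv ?_
    rw [dotProduct_self_eq_zero.1 h.symm]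
    simp
  have huv' : 0 < (u + v) ⬝ᵥ (u + v) := by
    refine lt_of_le_of_ne (by simpa using dotProduct_star_self_nonneg (u + v)) fun h => huv ?_
    rw [eq_neg_of_add_eq_zero_left (dotProduct_self_eq_zero.1 h.symm)]
    simp
  have eAuu := dotProduct_mulVec_of_mem_SO hA u u
  have eBvv := dotProduct_mulVec_of_mem_SO hB v v
  have eAww := dotProduct_mulVec_of_mem_SO hA (u + v) (u + v)
  have eA := dotProduct_mulVec_of_mem_SO hA u (u + v)
  have eB := dotProduct_mulVec_of_mem_SO hB u v
  have eC := dotProduct_mulVec_of_mem_SO hC v (u + v)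
  have fin : ∀ σ : ℝ, A *ᵥ u = σ • u' → B *ᵥ u = σ • u' → B *ᵥ v = σ • v' →
      A *ᵥ (u + v) = σ • (u' + v') → A = B ∧ u' = A *ᵥ u := fun σ a b c d =>
    eq_of_mulVec_triangle hA hB huv hAB a b c d
  have comm := dotProduct_comm v u
  have comm' := dotProduct_comm v' u'
  rcases mulVec_eq_or_eq_neg_of_crossMatrix_eq hA hB hAB with ⟨h1, h2⟩ | ⟨h1, h2⟩ <;>
  rcases mulVec_eq_or_eq_neg_of_crossMatrix_eq hB hC hBC with ⟨h3, h4⟩ | ⟨h3, h4⟩ <;>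
  rcases mulVec_eq_or_eq_neg_of_crossMatrix_eq hA hC hAC with ⟨h5, h6⟩ | ⟨h5, h6⟩
  · exact fin 1 (by simpa using h1) (by simpa using h2) (by simpa using h3) (by simpa using h5)
  -- With mixed signs, one side of the triangle has the odd sign. Lengths and the inner product of
  -- the other two sides are preserved, so the odd side is orthogonal to both; being a combination
  -- of them, it vanishes.
  all_goals first
    | exact fin (-1) (by simpa using h1) (by simpa using h2) (by simpa using h3)
        (by simpa [add_comm] using h5)
    | exfalso
      rw [h1] at eAuu
      rw [h3] at eBvv
      rw [h5] at eAww
      rw [h1, h5] at eA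
      rw [h2, h3] at eB
      rw [h4, h6] at eC
      simp only [neg_dotProduct, dotProduct_neg, add_dotProduct, dotProduct_add, comm, comm',
        neg_neg] at eAuu eBvv eAww eA eB eC huv'
      linarith

/-- This is `u × (u × w) = (u·w) u - (u·u) w`, read componentwise. -/
theorem eq_smul_of_crossProduct_eq_zero {u w : Fin 3 → ℝ} (hu : u ≠ 0)
    (h : crossProduct u w = 0) : w = ((u ⬝ᵥ w) / (u ⬝ᵥ u)) • u := by
  have hN : u ⬝ᵥ u ≠ 0 := fun h => hu (dotProduct_self_eq_zero.1 h)
  have h0 := congrFun h 0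
  have h1 := congrFun h 1
  have h2 := congrFun h 2
  simp only [cross_apply, cons_val_zero, cons_val_one, cons_val, Pi.zero_apply]
    at h0 h1 h2
  ext i
  rw [Pi.smul_apply, smul_eq_mul, div_mul_eq_mul_div, eq_div_iff hN]
  fin_cases i <;> simp only [dotProduct, Fin.sum_univ_three, Fin.zero_eta, Fin.mk_one,
    Fin.reduceFinMk]
  · linear_combination u 1 * (-h2) + u 2 * h1
  · linear_combination u 0 * h2 - u 2 * h0
  · linear_combination u 1 * h0 - u 0 * h1

theorem exists_crossProduct_ne_zero {ι : Type*} {t : ι → Fin 3 → ℝ}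
    (ht : ¬ Collinear ℝ (Set.range t)) {i j : ι} (hij : t i ≠ t j) :
    ∃ k, crossProduct (t i - t j) (t j - t k) ≠ 0 := by
  by_contra! hk
  refine ht ((collinear_iff_of_mem (Set.mem_range_self j)).2 ⟨t i - t j, ?_⟩)
  rintro _ ⟨k, rfl⟩
  have := eq_smul_of_crossProduct_eq_zero (sub_ne_zero.2 hij) (hk k)
  refine ⟨-(((t i - t j) ⬝ᵥ (t j - t k)) / ((t i - t j) ⬝ᵥ (t i - t j))), ?_⟩
  rw [neg_smul, ← this, vadd_eq_add]
  abel

theorem ConsistentWith.location_ne {n : ℕ} {E : Matrix (Fin n × Fin 3) (Fin n × Fin 3) ℝ}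
    (hE : IsNViewEssential E) {P : Fin n → Camera} (hP : ConsistentWith P E) {i j : Fin n}
    (hij : i ≠ j) : (P i).t ≠ (P j).t := by
  intro h
  have := hE.rank_two i j hij
  rw [hP i j, h, sub_self, mul_zero, zero_mul, rank_zero] at this
  norm_num at this

theorem ConsistentWith.crossMatrix_eq {n : ℕ} {E : Matrix (Fin n × Fin 3) (Fin n × Fin 3) ℝ}
    {P P' : Fin n → Camera} (hP : ConsistentWith P E) (hP' : ConsistentWith P' E) (i j : Fin n) :
    crossMatrix ((P' i).t - (P' j).t) = ((P' i).R * (P i).Rᵀ) *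
      crossMatrix ((P i).t - (P j).t) * ((P' j).R * (P j).Rᵀ)ᵀ := by
  rw [crossMatrix_sub, crossMatrix_sub, transpose_mul, transpose_transpose]
  have h := (hP i j).symm.trans (hP' i j)
  set X := crossMatrix (P i).t - crossMatrix (P j).t
  set Y := crossMatrix (P' i).t - crossMatrix (P' j).t
  calc Y = ((P' i).R * (P' i).Rᵀ) * Y * ((P' j).R * (P' j).Rᵀ) := by
        rw [self_mul_transpose_of_mem_SO (P' i).R_mem, self_mul_transpose_of_mem_SO (P' j).R_mem,
          one_mul, mul_one]
    _ = (P' i).R * ((P' i).Rᵀ * Y * (P' j).R) * (P' j).Rᵀ := by simp only [mul_assoc]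
    _ = _ := by rw [← h]; simp only [mul_assoc]

theorem NonCollinear.nonempty {n : ℕ} {P : Fin n → Camera} (h : NonCollinear P) :
    Nonempty (Fin n) := by
  by_contra hn
  rw [not_nonempty_iff] at hn
  exact h (by simpa only [Set.range_eq_empty] using collinear_empty ℝ (Fin 3 → ℝ))

end MultiView

open Matrix in
theorem mainTheorem2 (n : ℕ) (E : Matrix (Fin n × Fin 3) (Fin n × Fin 3) ℝ)
    (hE : MultiView.IsConsistentEssential E)
    (P : Fin n → MultiView.Camera) (hP : MultiView.ConsistentWith P E)
    (hncol : MultiView.NonCollinear P)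
    (P' : Fin n → MultiView.Camera) (hP' : MultiView.ConsistentWith P' E) :
    ∃ S : MultiView.Similarity, ∀ i, (P' i).toMatrix = S.apply (P i).toMatrix := by
  obtain ⟨o⟩ := hncol.nonempty
  set A : Fin n → Matrix (Fin 3) (Fin 3) ℝ := fun i => (P' i).R * (P i).Rᵀ with hAdef
  have hA : ∀ i, A i ∈ specialOrthogonalGroup (Fin 3) ℝ := fun i =>
    mul_mem (P' i).R_mem (MultiView.transpose_mem_SO (P i).R_mem)
  have hcross := MultiView.ConsistentWith.crossMatrix_eq hP hP'
  have hpair : ∀ i, A o = A i ∧ (P' o).t - (P' i).t = A o *ᵥ ((P o).t - (P i).t) := by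
    intro i
    by_cases hi : o = i
    · subst hi
      simp
    -- The third vertex `k` may depend on `i`; only `o` stays fixed.
    obtain ⟨k, hk⟩ := MultiView.exists_crossProduct_ne_zero hncol
      (MultiView.ConsistentWith.location_ne hE.1 hP hi)
    refine MultiView.eq_of_crossMatrix_triangle (hA o) (hA i) (hA k) hk (hcross o i)
      (hcross i k) ?_
    rw [sub_add_sub_cancel, sub_add_sub_cancel]
    exact hcross o k
  -- The scale is `1` since `E` fixes the baseline lengths. The similarity acts from the primed
  -- world to the unprimed one, hence the inverse rotation and the translation sending `t'_o` to
  -- `t_o`.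
  refine ⟨⟨1, one_pos, (A o)ᵀ, MultiView.transpose_mem_SO (hA o),
    (P o).t - (A o)ᵀ *ᵥ (P' o).t⟩, fun i => ?_⟩
  have hR : (P i).Rᵀ * (A o)ᵀ = (P' i).Rᵀ := by
    rw [(hpair i).1, ← transpose_mul]
    simp only [hAdef, mul_assoc]
    rw [MultiView.transpose_mul_self_of_mem_SO (P i).R_mem, mul_one]
  have ht : (P o).t - (A o)ᵀ *ᵥ (P' o).t - (P i).t = -((A o)ᵀ *ᵥ (P' i).t) := by
    have h := congrArg ((A o)ᵀ *ᵥ ·) (hpair i).2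
    simp only [mulVec_mulVec, MultiView.transpose_mul_self_of_mem_SO (hA o), one_mulVec,
      mulVec_sub] at h
    rw [sub_right_comm, ← h]
    abel
  rw [MultiView.Similarity.apply_toMatrix, MultiView.Camera.toMatrix]
  dsimp only
  rw [ht, hR, inv_one, one_smul, mulVec_neg, mulVec_mulVec, hR]
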